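/- Let $\mathcal P_2(\mathbb R^d)$ be the set of Borel probability measures on $\mathbb R^d$ with finite second moment. For $\mu,\nu\in\mathcal P_2(\mathbb R^d)$ let $\Pi(\mu,\nu)$ be the set of probability measures on $\mathbb R^d\times\mathbb R^d$ with first marginal $\mu$ and second marginal $\nu$, and let $$W_2^2(\mu,\nu)=\inf_{\gamma\in\Pi(\mu,\nu)}\int|x-y|^2\,\gamma(dx,dy).$$ A function $F:\mathcal P_2(\mathbb R^d)\to\mathbb R$ is called differentiable at $\mu$ if there is $\phi\in L^2_\mu(\mathbb R^d,\mathbb R^d)$ such that $$F(\mu')-F(\mu)=\int \phi(x)\cdot(y-x)\,\gamma(dx,dy)+o\Big(\Big(\int|x-y|^2\,\gamma(dx,dy)\Big)^{1/2}\Big)$$ for $\mu'\in\mathcal P_2(\mathbb R^d)$ and $\gamma\in\Pi(\mu,\mu')$, the $o(\cdot)$ being uniform in $\mu'$ and $\gamma$; one then writes $D_\mu F(\mu,\cdot)=\phi$, an element of $L^2_\mu$. Fix $\nu\in\mathcal P_2(\mathbb R^d)$, put $\Phi(\mu)=W_2^2(\mu,\nu)$ and, for $\delta\in(0,1)$, $$\Phi_\delta(\mu)=\sup_{\mu'\in\mathcal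 P_2(\mathbb R^d)}\Big\{W_2^2(\mu',\nu)-\frac1\delta W_2^2(\mu',\mu)\Big\}.$$ Let $\mu\in\mathcal P_2(\mathbb R^d)$ be a point of differentiability of $\Phi$, let $(\delta_n)_{n\ge0}$ be positive numbers with $\delta_n\to0$, let $(\mu_n)_{n\ge0}$ be a sequence in $\mathcal P_2(\mathbb R^d)$ with $W_2(\mu_n,\mu)\to0$, and let $\gamma_n\in\Pi(\mu,\mu_n)$ be such that $$\lim_{n\to\infty}\int|x-y|^2\,\gamma_n(dx,dy)=0.$$ Then $\Phi_{\delta_n}$ is differentiable at $\mu_n$ for every $n$ with $\delta_n<1$ (hence for all large $n$), and $$\lim_{n\to\infty}\int_{\mathbb R^d\times\mathbb R^d}\big|D_\mu\Phi_{\delta_n}(\mu_n,y)-D_\mu\Phi(\mu,x)\big|^2\,\gamma_n(dx,dy)=0.$$ -/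

import Mathlib

open MeasureTheory Filter Topology

/-- Borel probability measures on `ℝ^d` with finite second moment. -/
def P2 (d : ℕ) : Type :=
  {μ : Measure (EuclideanSpace ℝ (Fin d)) //
    IsProbabilityMeasure μ ∧ Integrable (fun x => ‖x‖ ^ 2) μ}

/-- The set `Π(μ, ν)` of couplings: probability measures on `ℝ^d × ℝ^d` with first marginal `μ`
and second marginal `ν`. -/
def couplings {d : ℕ} (μ ν : P2 d) :
    Set (Measure (EuclideanSpace ℝ (Fin d) × EuclideanSpace ℝ (Fin d))) :=
  {γ | IsProbabilityMeasure γ ∧ γ.map Prod.fst = μ.1 ∧ γ.map Prod.snd = ν.1}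

/-- The quadratic transport cost `∫ |x - y|² dγ(x, y)`. (For a coupling of two elements of `P2 d`
the integrand is always integrable.) -/
noncomputable def transportCost {d : ℕ}
    (γ : Measure (EuclideanSpace ℝ (Fin d) × EuclideanSpace ℝ (Fin d))) : ℝ :=
  ∫ p, ‖p.1 - p.2‖ ^ 2 ∂γ

/-- The squared Wasserstein distance `W₂²(μ, ν)`. The infimum is over a nonempty set of
nonnegative numbers. -/
noncomputable def W2sq {d : ℕ} (μ ν : P2 d) : ℝ :=
  sInf (transportCost '' couplings μ ν)

/-- The Wasserstein distance `W₂(μ, ν)`. -/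
noncomputable def W2 {d : ℕ} (μ ν : P2 d) : ℝ :=
  Real.sqrt (W2sq μ ν)

/-- The sup-convolution
`Φ_δ(μ) = sup_{μ'} (W₂²(μ', ν) - δ⁻¹ W₂²(μ', μ))`; the supremum is finite for `0 < δ < 1`. -/
noncomputable def supConv {d : ℕ} (ν : P2 d) (δ : ℝ) (μ : P2 d) : ℝ :=
  ⨆ μ' : P2 d, (W2sq μ' ν - 1 / δ * W2sq μ' μ)

/-- `F` is differentiable at `μ`, with differential `D_μ F(μ, ·) = φ`: the function `φ` is in
`L²(μ; ℝ^d)` and, for all `μ'` and all `γ ∈ Π(μ, μ')`,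
`F(μ') - F(μ) = ∫ φ(x) · (y - x) dγ(x, y) + o((∫ |x - y|² dγ)^{1/2})`. -/
def HasWDifferentialAt {d : ℕ} (F : P2 d → ℝ) (μ : P2 d)
    (φ : EuclideanSpace ℝ (Fin d) → EuclideanSpace ℝ (Fin d)) : Prop :=
  MemLp φ 2 μ.1 ∧
    ∀ ε : ℝ, 0 < ε → ∃ η : ℝ, 0 < η ∧
      ∀ μ' : P2 d, ∀ γ ∈ couplings μ μ', Real.sqrt (transportCost γ) ≤ η →
        |F μ' - F μ - ∫ p, inner ℝ (φ p.1) (p.2 - p.1) ∂γ| ≤ ε * Real.sqrt (transportCost γ)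

/-! Everything is lifted to random vectors: on a probability space, `U f = W2sq (law P f) ν` is a
function on the Hilbert space `L²(P)`. Testing with a near-optimal partner of law `ν` shows that `U
- ‖·‖²` is concave (`W2sq_law_semiconcave`). For `δ < 1` the functional `U T - ‖T - id‖²/δ` is
therefore strongly concave, with a constant `1/δ - 1`. Barycentric projection (`exists_barycenter`)
shows that maps `T ∈ L²(μ)` already exhaust the supremum defining `Φ_δ(μ)`; strong concavity and
completeness then give a maximiser `T`, with quadratic growth against competitors on any extended
space (`sub_norm_sq_add_le_supConv`). Comparing the maximisers at two measures yields
differentiability of `Φ_δ`, with differential `p = (2/δ)(T - id)`. The same growth makes `p` a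
supergradient of `U` at `T`, with error `‖g - T‖²` whatever `δ` is. As `δ → 0` the displacement `T -
id` vanishes, so in `L²(γ n)` these base points approach the point where `U` is differentiable, and
supergradients at nearby points converge to the gradient (`norm_sub_le_of_supergradient`). -/

open ProbabilityTheory

/-- Euclidean space of dimension `d`. -/
abbrev Euc (d : ℕ) : Type := EuclideanSpace ℝ (Fin d)

/-! ### Random vectors, couplings and semiconcavity of the squared distance -/

section Lift

variable {d : ℕ} {Ω Ω' : Type*} [MeasurableSpace Ω] [MeasurableSpace Ω']

instance P2.isProbabilityMeasure (μ : P2 d) : IsProbabilityMeasure μ.1 := μ.2.1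

/-- Composition with a measure-preserving map, as an isometric embedding of `L²` spaces. -/
noncomputable def pull {P : Measure Ω} {Q : Measure Ω'} (X : Ω → Ω')
    (hX : MeasurePreserving X P Q) : Lp (Euc d) 2 Q →ₗᵢ[ℝ] Lp (Euc d) 2 P :=
  Lp.compMeasurePreservingₗᵢ ℝ X hX

lemma coeFn_pull {P : Measure Ω} {Q : Measure Ω'} {X : Ω → Ω'}
    (hX : MeasurePreserving X P Q) (f : Lp (Euc d) 2 Q) :
    pull X hX f =ᵐ[P] f ∘ X :=
  Lp.coeFn_compMeasurePreserving f hX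

lemma measurable_coeFn_lp {P : Measure Ω} (f : Lp (Euc d) 2 P) : Measurable f :=
  (Lp.stronglyMeasurable f).measurable

lemma norm_sq_eq_integral {P : Measure Ω} (f : Lp (Euc d) 2 P) :
    ‖f‖ ^ 2 = ∫ ω, ‖f ω‖ ^ 2 ∂P := by
  rw [← real_inner_self_eq_norm_sq, MeasureTheory.L2.inner_def]
  simp_rw [real_inner_self_eq_norm_sq]

/-- The law of a square-integrable random vector. -/
noncomputable def law (P : Measure Ω) [IsProbabilityMeasure P] (f : Lp (Euc d) 2 P) : P2 d :=
  ⟨P.map f, Measure.isProbabilityMeasure_map (measurable_coeFn_lp f).aemeasurable, by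
    rw [integrable_map_measure (by fun_prop) (measurable_coeFn_lp f).aemeasurable]
    exact (Lp.memLp f).integrable_norm_pow (p := 2) two_ne_zero⟩

lemma measurePreserving_law (P : Measure Ω) [IsProbabilityMeasure P] (f : Lp (Euc d) 2 P) :
    MeasurePreserving f P (law P f).1 :=
  ⟨measurable_coeFn_lp f, rfl⟩

lemma memLp_id (μ : P2 d) : MemLp (fun x : Euc d => x) 2 μ.1 :=
  (memLp_two_iff_integrable_sq_norm (by fun_prop)).2 μ.2.2

/-- The identity map as an element of `L²(μ)`. -/
noncomputable def idLp (μ : P2 d) : Lp (Euc d) 2 μ.1 := (memLp_id μ).toLp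

lemma coeFn_idLp (μ : P2 d) : idLp μ =ᵐ[μ.1] fun x => x := (memLp_id μ).coeFn_toLp

lemma coeFn_pull_idLp {P : Measure Ω} {μ : P2 d} {X : Ω → Euc d}
    (hX : MeasurePreserving X P μ.1) : pull X hX (idLp μ) =ᵐ[P] X := by
  filter_upwards [coeFn_pull hX (idLp μ),
    hX.quasiMeasurePreserving.ae_eq_comp (coeFn_idLp μ)] with ω h1 h2
  rw [h1, h2]; rfl

lemma law_pull {P : Measure Ω} [IsProbabilityMeasure P] {Q : Measure Ω'} [IsProbabilityMeasure Q]
    {X : Ω → Ω'} (hX : MeasurePreserving X P Q) (f : Lp (Euc d) 2 Q) :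
    law P (pull X hX f) = law Q f := by
  apply Subtype.ext
  change P.map _ = Q.map _
  rw [Measure.map_congr (coeFn_pull hX f)]
  exact ((measurePreserving_law Q f).comp hX).map_eq

lemma law_pull_idLp {P : Measure Ω} [IsProbabilityMeasure P] {μ : P2 d} {X : Ω → Euc d}
    (hX : MeasurePreserving X P μ.1) : law P (pull X hX (idLp μ)) = μ := by
  apply Subtype.ext
  change P.map _ = _
  rw [Measure.map_congr (coeFn_pull_idLp hX), hX.map_eq]

lemma law_idLp (μ : P2 d) : law μ.1 (idLp μ) = μ := by
  apply Subtype.ext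
  change μ.1.map _ = _
  rw [Measure.map_congr (coeFn_idLp μ), Measure.map_id']

lemma transportCost_nonneg (γ : Measure (Euc d × Euc d)) : 0 ≤ transportCost γ :=
  integral_nonneg fun _ => by positivity

lemma W2sq_le_transportCost {μ ν : P2 d} {γ : Measure (Euc d × Euc d)}
    (hγ : γ ∈ couplings μ ν) : W2sq μ ν ≤ transportCost γ :=
  csInf_le ⟨0, by rintro _ ⟨γ, -, rfl⟩; exact transportCost_nonneg γ⟩ ⟨γ, hγ, rfl⟩

lemma prod_mem_couplings (μ ν : P2 d) : μ.1.prod ν.1 ∈ couplings μ ν :=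
  ⟨inferInstance, by simp, by simp⟩

lemma exists_coupling_lt (μ ν : P2 d) {ε : ℝ} (hε : 0 < ε) :
    ∃ γ ∈ couplings μ ν, transportCost γ < W2sq μ ν + ε := by
  obtain ⟨_, ⟨γ, hγ, rfl⟩, h⟩ := exists_lt_of_csInf_lt
    (Set.Nonempty.image transportCost ⟨_, prod_mem_couplings μ ν⟩)
    (lt_add_of_pos_right (W2sq μ ν) hε)
  exact ⟨γ, hγ, h⟩

lemma measurePreserving_fst {μ ν : P2 d} {γ : Measure (Euc d × Euc d)}
    (hγ : γ ∈ couplings μ ν) : MeasurePreserving Prod.fst γ μ.1 := ⟨measurable_fst, hγ.2.1⟩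

lemma measurePreserving_snd {μ ν : P2 d} {γ : Measure (Euc d × Euc d)}
    (hγ : γ ∈ couplings μ ν) : MeasurePreserving Prod.snd γ ν.1 := ⟨measurable_snd, hγ.2.2⟩

lemma map_prodMk_mem_couplings {P : Measure Ω} [IsProbabilityMeasure P] {μ ν : P2 d}
    {X Y : Ω → Euc d} (hX : MeasurePreserving X P μ.1) (hY : MeasurePreserving Y P ν.1) :
    P.map (fun ω => (X ω, Y ω)) ∈ couplings μ ν := by
  have hm := hX.measurable.prodMk hY.measurable
  refine ⟨Measure.isProbabilityMeasure_map hm.aemeasurable, ?_, ?_⟩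
  · rw [Measure.map_map measurable_fst hm]; exact hX.map_eq
  · rw [Measure.map_map measurable_snd hm]; exact hY.map_eq

lemma transportCost_map {P : Measure Ω} {X Y : Ω → Euc d} (hX : Measurable X)
    (hY : Measurable Y) :
    transportCost (P.map fun ω => (X ω, Y ω)) = ∫ ω, ‖X ω - Y ω‖ ^ 2 ∂P := by
  rw [transportCost, integral_map (hX.prodMk hY).aemeasurable (by fun_prop)]

lemma norm_sub_sq_eq_integral {P : Measure Ω} {f g : Lp (Euc d) 2 P} {X Y : Ω → Euc d}
    (hf : f =ᵐ[P] X) (hg : g =ᵐ[P] Y) : ‖f - g‖ ^ 2 = ∫ ω, ‖X ω - Y ω‖ ^ 2 ∂P := by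
  rw [norm_sq_eq_integral]
  apply integral_congr_ae
  filter_upwards [Lp.coeFn_sub f g, hf, hg] with ω h1 h2 h3
  rw [h1, Pi.sub_apply, h2, h3]

lemma transportCost_eq_norm_sq {μ ν : P2 d} {γ : Measure (Euc d × Euc d)}
    (hγ : γ ∈ couplings μ ν) :
    transportCost γ = ‖pull Prod.fst (measurePreserving_fst hγ) (idLp μ)
      - pull Prod.snd (measurePreserving_snd hγ) (idLp ν)‖ ^ 2 := by
  rw [norm_sub_sq_eq_integral (coeFn_pull_idLp _) (coeFn_pull_idLp _)]
  rfl

lemma W2sq_law_le (P : Measure Ω) [IsProbabilityMeasure P] (f g : Lp (Euc d) 2 P) :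
    W2sq (law P f) (law P g) ≤ ‖f - g‖ ^ 2 := by
  refine (W2sq_le_transportCost (map_prodMk_mem_couplings (measurePreserving_law P f)
    (measurePreserving_law P g))).trans_eq ?_
  rw [transportCost_map (measurable_coeFn_lp f) (measurable_coeFn_lp g),
    norm_sub_sq_eq_integral (ae_eq_refl _) (ae_eq_refl _)]

/-- Gluing: extending the probability space by the conditional law of the second coordinate
under `π` given that the first one is `X`. -/
lemma map_compProd_condKernel_comap {P : Measure Ω} [IsProbabilityMeasure P] {X : Ω → Euc d}
    (hX : Measurable X) {π : Measure (Euc d × Euc d)} [IsFiniteMeasure π]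
    (hπ : P.map X = π.fst) :
    (P ⊗ₘ π.condKernel.comap X hX).map (fun p => (X p.1, p.2)) = π := by
  have hm : Measurable (fun p : Ω × Euc d => (X p.1, p.2)) :=
    (hX.comp measurable_fst).prodMk measurable_snd
  refine Measure.ext_of_lintegral _ fun f hf => ?_
  -- Both sides reduce to the iterated integral of `f` against `π.condKernel` and the law of `X`.
  rw [lintegral_map hf hm,
    Measure.lintegral_compProd (f := fun p => f (X p.1, p.2)) (hf.comp hm)]
  conv_rhs => rw [← π.disintegrate π.condKernel, Measure.lintegral_compProd hf]
  rw [← hπ, lintegral_map hf.lintegral_kernel_prod_right' hX]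
  rfl

lemma measurePreserving_snd_compProd {P : Measure Ω} [IsProbabilityMeasure P] {μ ν : P2 d}
    {X : Ω → Euc d} (hX : MeasurePreserving X P μ.1) {π : Measure (Euc d × Euc d)}
    [IsFiniteMeasure π] (hπ : π ∈ couplings μ ν) :
    MeasurePreserving Prod.snd (P ⊗ₘ π.condKernel.comap X hX.measurable) ν.1 := by
  have hπX : MeasurePreserving (fun p : Ω × Euc d => (X p.1, p.2))
      (P ⊗ₘ π.condKernel.comap X hX.measurable) π :=
    ⟨(hX.measurable.comp measurable_fst).prodMk measurable_snd,
      map_compProd_condKernel_comap hX.measurable (hX.map_eq.trans hπ.2.1.symm)⟩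
  exact (measurePreserving_snd hπ).comp hπX

lemma measurePreserving_fst_compProd (P : Measure Ω) [IsProbabilityMeasure P]
    (κ : Kernel Ω (Euc d)) [IsMarkovKernel κ] : MeasurePreserving Prod.fst (P ⊗ₘ κ) P :=
  ⟨measurable_fst, Measure.fst_compProd P κ⟩

/-- A random vector can be completed to an almost optimal coupling with `ν` on an extension of
the probability space. -/
lemma exists_extension_W2sq (P : Measure Ω) [IsProbabilityMeasure P] (f : Lp (Euc d) 2 P)
    (ν : P2 d) {ε : ℝ} (hε : 0 < ε) :
    ∃ (Q : Measure (Ω × Euc d)) (_ : IsProbabilityMeasure Q)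
      (h1 : MeasurePreserving Prod.fst Q P) (h2 : MeasurePreserving Prod.snd Q ν.1),
      ‖pull Prod.fst h1 f - pull Prod.snd h2 (idLp ν)‖ ^ 2 ≤ W2sq (law P f) ν + ε := by
  obtain ⟨π, hπ, hlt⟩ := exists_coupling_lt (law P f) ν hε
  have := hπ.1
  have hmap := map_compProd_condKernel_comap (measurable_coeFn_lp f) (π := π) hπ.2.1.symm
  refine ⟨_, inferInstance, measurePreserving_fst_compProd P _,
    measurePreserving_snd_compProd (measurePreserving_law P f) hπ, le_of_eq_of_le ?_ hlt.le⟩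
  rw [norm_sub_sq_eq_integral (coeFn_pull _ f) (coeFn_pull_idLp _)]
  conv_rhs => rw [← hmap]
  exact (transportCost_map (X := f ∘ Prod.fst)
    ((measurable_coeFn_lp f).comp measurable_fst) measurable_snd).symm

lemma W2sq_law_le_of_extension {P : Measure Ω} [IsProbabilityMeasure P] {ν : P2 d}
    {Q : Measure Ω'} [IsProbabilityMeasure Q] {X : Ω' → Ω} {Z : Ω' → Euc d}
    (h1 : MeasurePreserving X Q P) (h2 : MeasurePreserving Z Q ν.1) (g : Lp (Euc d) 2 P) :
    W2sq (law P g) ν ≤ ‖pull X h1 g - pull Z h2 (idLp ν)‖ ^ 2 := by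
  have := W2sq_law_le Q (pull X h1 g) (pull Z h2 (idLp ν))
  rwa [law_pull, law_pull_idLp] at this

lemma norm_add_sq_le {H : Type*} [NormedAddCommGroup H] [InnerProductSpace ℝ H] (a b : H) {θ : ℝ}
    (hθ : 0 < θ) : ‖a + b‖ ^ 2 ≤ (1 + θ) * ‖a‖ ^ 2 + (1 + 1 / θ) * ‖b‖ ^ 2 := by
  have h := norm_add_le a b
  have h2 : ‖a + b‖ ^ 2 ≤ (‖a‖ + ‖b‖) ^ 2 := by gcongr
  have h3 : 0 ≤ (θ * ‖a‖ - ‖b‖) ^ 2 / θ := by positivity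
  have h4 : (θ * ‖a‖ - ‖b‖) ^ 2 / θ = θ * ‖a‖ ^ 2 - 2 * ‖a‖ * ‖b‖ + 1 / θ * ‖b‖ ^ 2 := by
    field_simp
    ring
  nlinarith

/-- Young's inequality applied to a near-optimal partner of `f`. The free `θ` serves three ends: `θ
→ 0` gives upper semicontinuity, `θ = δ/(1 - δ)` the finiteness of `supConv`, `θ = 1` crude bounds.
-/
lemma W2sq_law_le_add (P : Measure Ω) [IsProbabilityMeasure P] (f g : Lp (Euc d) 2 P) (ν : P2 d)
    {θ : ℝ} (hθ : 0 < θ) :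
    W2sq (law P g) ν ≤ (1 + θ) * W2sq (law P f) ν + (1 + 1 / θ) * ‖g - f‖ ^ 2 := by
  refine le_of_forall_pos_le_add fun ε hε => ?_
  obtain ⟨Q, hQ, h1, h2, h⟩ := exists_extension_W2sq P f ν (ε := ε / (1 + θ)) (by positivity)
  have h3 := W2sq_law_le_of_extension h1 h2 g
  have h4 := norm_add_sq_le (pull Prod.fst h1 f - pull Prod.snd h2 (idLp ν))
    (pull Prod.fst h1 (g - f)) hθ
  rw [LinearIsometry.norm_map] at h4
  rw [show pull Prod.fst h1 g - pull Prod.snd h2 (idLp ν) =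
    pull Prod.fst h1 f - pull Prod.snd h2 (idLp ν) + pull Prod.fst h1 (g - f) by
      rw [map_sub]; abel] at h3
  have h5 := mul_le_mul_of_nonneg_left h (by positivity : 0 ≤ 1 + θ)
  rw [mul_add, mul_div_cancel₀ _ (by positivity)] at h5
  linarith

lemma norm_convexComb_sub_sq {H : Type*} [NormedAddCommGroup H] [InnerProductSpace ℝ H]
    (a b z : H) (t : ℝ) :
    ‖(1 - t) • a + t • b - z‖ ^ 2 =
      (1 - t) * ‖a - z‖ ^ 2 + t * ‖b - z‖ ^ 2 - t * (1 - t) * ‖a - b‖ ^ 2 := by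
  have h1 : (1 - t) • a + t • b - z = (1 - t) • (a - z) + t • (b - z) := by module
  have h2 : a - b = (a - z) - (b - z) := by abel
  rw [h1, h2]
  generalize a - z = u, b - z = v
  rw [norm_add_sq_real, norm_sub_sq_real, norm_smul, norm_smul, mul_pow, mul_pow,
    real_inner_smul_left, real_inner_smul_right]
  simp only [Real.norm_eq_abs, sq_abs]
  ring

/-- The squared distance to `ν` is semiconcave along all interpolations. -/
lemma W2sq_law_semiconcave (P : Measure Ω) [IsProbabilityMeasure P] (f g : Lp (Euc d) 2 P)
    (ν : P2 d) {t : ℝ} (h0 : 0 ≤ t) (h1 : t ≤ 1) :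
    (1 - t) * W2sq (law P f) ν + t * W2sq (law P g) ν - t * (1 - t) * ‖f - g‖ ^ 2
      ≤ W2sq (law P ((1 - t) • f + t • g)) ν := by
  refine le_of_forall_pos_le_add fun ε hε => ?_
  -- A single partner, near-optimal for the interpolated vector, is tested at both endpoints.
  obtain ⟨Q, hQ, hP, hZ, h⟩ := exists_extension_W2sq P ((1 - t) • f + t • g) ν hε
  have hf := mul_le_mul_of_nonneg_left (W2sq_law_le_of_extension hP hZ f) (sub_nonneg.2 h1)
  have hg := mul_le_mul_of_nonneg_left (W2sq_law_le_of_extension hP hZ g) h0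
  rw [map_add, map_smul, map_smul, norm_convexComb_sub_sq, ← map_sub,
    LinearIsometry.norm_map] at h
  linarith

end Lift
-- Barycentric projection of couplings
section Barycenter

variable {d : ℕ}

lemma integrable_id_of_sq {κ : Measure (Euc d)} [IsProbabilityMeasure κ]
    (h : Integrable (fun y => ‖y‖ ^ 2) κ) : Integrable (fun y => y) κ :=
  ((memLp_two_iff_integrable_sq_norm (by fun_prop)).2 h).integrable one_le_two

/-- The bias-variance decomposition. -/
lemma integral_norm_sub_sq_eq {κ : Measure (Euc d)} [IsProbabilityMeasure κ]
    (h : Integrable (fun y => ‖y‖ ^ 2) κ) (z : Euc d) :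
    ∫ y, ‖y - z‖ ^ 2 ∂κ = ‖(∫ y, y ∂κ) - z‖ ^ 2 + ∫ y, ‖y - ∫ y, y ∂κ‖ ^ 2 ∂κ := by
  set m := ∫ y, y ∂κ with hm
  have hid := integrable_id_of_sq h
  have hL2 : MemLp (fun y : Euc d => y) 2 κ := (memLp_two_iff_integrable_sq_norm (by fun_prop)).2 h
  have hsq : Integrable (fun y => ‖y - m‖ ^ 2) κ :=
    (hL2.sub (memLp_const m)).integrable_norm_pow (p := 2) two_ne_zero
  have hsub : Integrable (fun y => y - m) κ := hid.sub (integrable_const m)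
  have hinner : Integrable (fun y => 2 * inner ℝ (m - z) (y - m)) κ :=
    (hsub.const_inner (m - z)).const_mul 2
  have h0 : ∫ y, inner ℝ (m - z) (y - m) ∂κ = 0 := by
    rw [integral_inner hsub, integral_sub hid (integrable_const m),
      integral_const, probReal_univ, one_smul, ← hm, sub_self, inner_zero_right]
  have hexp : ∀ y, ‖y - z‖ ^ 2 = ‖m - z‖ ^ 2 + 2 * inner ℝ (m - z) (y - m) + ‖y - m‖ ^ 2 := by
    intro y
    rw [← norm_add_sq_real]
    congr 2
    abel
  rw [integral_congr_ae (ae_of_all _ hexp),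
    integral_add (f := fun y => ‖m - z‖ ^ 2 + 2 * inner ℝ (m - z) (y - m))
      ((integrable_const _).add hinner) hsq,
    integral_add (integrable_const _) hinner, integral_const_mul, h0]
  simp

/-- The barycentric projection of a coupling is a map which loses the same amount `V` of variance
in both transport costs. -/
lemma exists_barycenter {μ μ' : P2 d} {γ : Measure (Euc d × Euc d)} (hγ : γ ∈ couplings μ μ') :
    ∃ (T : Lp (Euc d) 2 μ.1) (V : ℝ), 0 ≤ V ∧ transportCost γ = ‖T - idLp μ‖ ^ 2 + V ∧
      ∀ ν : P2 d, W2sq μ' ν ≤ W2sq (law μ.1 T) ν + V := by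
  have := hγ.1
  let κ := γ.condKernel
  have hdis : μ.1 ⊗ₘ κ = γ := by
    rw [← hγ.2.1]
    exact γ.disintegrate γ.condKernel
  have hsq : Integrable (fun p : Euc d × Euc d => ‖p.2‖ ^ 2) (μ.1 ⊗ₘ κ) := by
    rw [hdis]
    exact (measurePreserving_snd hγ).integrable_comp_of_integrable μ'.2.2
  obtain ⟨hae, hint⟩ := (Measure.integrable_compProd_iff hsq.1).1 hsq
  simp only [norm_pow, norm_norm] at hint
  let T₀ : Euc d → Euc d := fun x => ∫ y, y ∂κ x
  have hT₀ : StronglyMeasurable T₀ :=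
    StronglyMeasurable.integral_kernel (f := fun y : Euc d => y) measurable_id.stronglyMeasurable
  let v : Euc d → ℝ := fun x => ∫ y, ‖y - T₀ x‖ ^ 2 ∂κ x
  have hv : ∀ x, 0 ≤ v x := fun x => integral_nonneg fun _ => by positivity
  -- The null set does not depend on `z`: below, `z` is `0`, then `x`, then a random partner of law
  -- `ν`.
  have hbv : ∀ᵐ x ∂μ.1, ∀ z, ∫ y, ‖y - z‖ ^ 2 ∂κ x = ‖T₀ x - z‖ ^ 2 + v x := by
    filter_upwards [hae] with x hx z
    exact integral_norm_sub_sq_eq hx z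
  have hT₀L : MemLp T₀ 2 μ.1 := by
    rw [memLp_two_iff_integrable_sq_norm hT₀.aestronglyMeasurable]
    refine hint.mono' (hT₀.norm.pow 2).aestronglyMeasurable ?_
    filter_upwards [hbv] with x hx
    have := hx 0
    simp only [sub_zero] at this
    rw [this, Real.norm_of_nonneg (by positivity)]
    linarith [hv x]
  have hvI : Integrable v μ.1 := by
    refine (hint.sub (hT₀L.integrable_norm_pow (p := 2) two_ne_zero)).congr ?_
    filter_upwards [hbv] with x hx
    have := hx 0
    simp only [sub_zero] at this
    simp [this]
  let T : Lp (Euc d) 2 μ.1 := hT₀L.toLp T₀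
  have hT : T =ᵐ[μ.1] T₀ := hT₀L.coeFn_toLp
  refine ⟨T, ∫ x, v x ∂μ.1, integral_nonneg hv, ?_, fun ν => ?_⟩
  · have hI : Integrable (fun p : Euc d × Euc d => ‖p.2 - p.1‖ ^ 2) (μ.1 ⊗ₘ κ) := by
      rw [hdis]
      exact (((memLp_id μ').comp_measurePreserving (measurePreserving_snd hγ)).sub
        ((memLp_id μ).comp_measurePreserving (measurePreserving_fst hγ))).integrable_norm_pow
          (p := 2) two_ne_zero
    have hI' : Integrable (fun x => ‖T₀ x - x‖ ^ 2) μ.1 :=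
      (hT₀L.sub (memLp_id μ)).integrable_norm_pow (p := 2) two_ne_zero
    rw [norm_sub_sq_eq_integral hT (coeFn_idLp μ), ← integral_add hI' hvI, transportCost]
    simp_rw [norm_sub_rev]
    rw [← hdis, Measure.integral_compProd (by simpa only [norm_sub_rev] using hI)]
    apply integral_congr_ae
    filter_upwards [hbv] with x hx
    simpa only [norm_sub_rev] using hx x
  · refine le_of_forall_pos_le_add fun ε hε => ?_
    obtain ⟨P, hP, h1, h2, h⟩ := exists_extension_W2sq μ.1 T ν hε
    -- The point of law `μ'` is drawn given `x` alone, hence conditionally independently of the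
    -- `ν`-partner of `T x`; so bias-variance applies with the partner as `z`.
    let Q := P ⊗ₘ γ.condKernel.comap Prod.fst h1.measurable
    have hQ1 : MeasurePreserving Prod.fst Q P := measurePreserving_fst_compProd P _
    have hQ2 : MeasurePreserving Prod.snd Q μ'.1 := measurePreserving_snd_compProd h1 hγ
    have hQ3 : MeasurePreserving (fun q => q.1.2) Q ν.1 := h2.comp hQ1
    have hle := W2sq_le_transportCost (map_prodMk_mem_couplings hQ2 hQ3)
    rw [transportCost_map hQ2.measurable hQ3.measurable] at hle
    have hI : Integrable (fun q : (Euc d × Euc d) × Euc d => ‖q.2 - q.1.2‖ ^ 2) Q :=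
      (((memLp_id μ').comp_measurePreserving hQ2).sub
        ((memLp_id ν).comp_measurePreserving hQ3)).integrable_norm_pow (p := 2) two_ne_zero
    have hI' : Integrable (fun p : Euc d × Euc d => ‖T₀ p.1 - p.2‖ ^ 2) P :=
      ((hT₀L.comp_measurePreserving h1).sub
        ((memLp_id ν).comp_measurePreserving h2)).integrable_norm_pow (p := 2) two_ne_zero
    have heq : ∫ q, ‖q.2 - q.1.2‖ ^ 2 ∂Q = ‖pull Prod.fst h1 T - pull Prod.snd h2 (idLp ν)‖ ^ 2
        + ∫ x, v x ∂μ.1 := by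
      have hT' : pull Prod.fst h1 T =ᵐ[P] fun p => T₀ p.1 :=
        (coeFn_pull h1 T).trans (h1.quasiMeasurePreserving.ae_eq_comp hT)
      have hvP : ∫ x, v x ∂μ.1 = ∫ p, v p.1 ∂P := by
        rw [← h1.map_eq, integral_map h1.measurable.aemeasurable
          (by rw [h1.map_eq]; exact hvI.1)]
      have hvI' : Integrable (fun p : Euc d × Euc d => v p.1) P :=
        h1.integrable_comp_of_integrable hvI
      rw [norm_sub_sq_eq_integral hT' (coeFn_pull_idLp h2), hvP, ← integral_add hI' hvI',
        Measure.integral_compProd hI]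
      apply integral_congr_ae
      filter_upwards [h1.quasiMeasurePreserving.ae hbv] with p hp
      exact hp p.2
    linarith

end Barycenter

/-! ### The sup-convolution: finiteness, maximiser, quadratic growth -/

section SupConv

variable {d : ℕ} {Ω : Type*} [MeasurableSpace Ω]

lemma swap_mem_couplings {μ ν : P2 d} {γ : Measure (Euc d × Euc d)} (hγ : γ ∈ couplings μ ν) :
    γ.map Prod.swap ∈ couplings ν μ := by
  have := hγ.1
  exact map_prodMk_mem_couplings (measurePreserving_snd hγ) (measurePreserving_fst hγ)

lemma transportCost_swap (γ : Measure (Euc d × Euc d)) :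
    transportCost (γ.map Prod.swap) = transportCost γ := by
  refine (transportCost_map measurable_snd measurable_fst).trans ?_
  simp_rw [norm_sub_rev]
  rfl

/-- The choice `θ = δ/(1 - δ)` makes `1 + 1/θ = 1/δ`, so the penalty absorbs the displacement. The
bound is uniform in `μ'`, which makes the real `⨆` a genuine supremum. -/
lemma W2sq_sub_le (ν μ μ' : P2 d) {δ : ℝ} (h0 : 0 < δ) (h1 : δ < 1) :
    W2sq μ' ν - 1 / δ * W2sq μ' μ ≤ 1 / (1 - δ) * W2sq μ ν := by
  have h1' : 0 < 1 - δ := sub_pos.2 h1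
  refine le_of_forall_pos_le_add fun ε hε => ?_
  obtain ⟨γ, hγ, hlt⟩ := exists_coupling_lt μ' μ (ε := δ * ε) (by positivity)
  have := hγ.1
  have h := W2sq_law_le_add γ (pull Prod.snd (measurePreserving_snd hγ) (idLp μ))
    (pull Prod.fst (measurePreserving_fst hγ) (idLp μ')) ν (θ := δ / (1 - δ)) (by positivity)
  rw [← transportCost_eq_norm_sq hγ, law_pull_idLp, law_pull_idLp] at h
  have e1 : 1 + δ / (1 - δ) = 1 / (1 - δ) := by field_simp; ring
  have e2 : 1 + 1 / (δ / (1 - δ)) = 1 / δ := by field_simp; ring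
  rw [e1, e2] at h
  have h3 := mul_le_mul_of_nonneg_left hlt.le (by positivity : 0 ≤ 1 / δ)
  have h4 : 1 / δ * (W2sq μ' μ + δ * ε) = 1 / δ * W2sq μ' μ + ε := by field_simp
  linarith

lemma sub_le_supConv (ν μ μ' : P2 d) {δ : ℝ} (h0 : 0 < δ) (h1 : δ < 1) :
    W2sq μ' ν - 1 / δ * W2sq μ' μ ≤ supConv ν δ μ :=
  le_ciSup (f := fun μ' => W2sq μ' ν - 1 / δ * W2sq μ' μ)
    ⟨_, by rintro _ ⟨μ', rfl⟩; exact W2sq_sub_le ν μ μ' h0 h1⟩ μ'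

lemma sub_norm_sq_le_supConv (P : Measure Ω) [IsProbabilityMeasure P] (ν : P2 d) {δ : ℝ}
    (h0 : 0 < δ) (h1 : δ < 1) (f g : Lp (Euc d) 2 P) :
    W2sq (law P g) ν - 1 / δ * ‖g - f‖ ^ 2 ≤ supConv ν δ (law P f) := by
  have h := mul_le_mul_of_nonneg_left (W2sq_law_le P g f) (by positivity : 0 ≤ 1 / δ)
  linarith [sub_le_supConv ν (law P f) (law P g) h0 h1]

/-- Replacing a coupling by its barycentric map lowers `W2sq · ν` by at most `V` and the penalty by
`V/δ ≥ V`, so the objective does not decrease. -/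
lemma exists_map_near_supConv (ν μ : P2 d) {δ : ℝ} (h0 : 0 < δ) (h1 : δ < 1) {ε : ℝ}
    (hε : 0 < ε) : ∃ T : Lp (Euc d) 2 μ.1,
      supConv ν δ μ - ε ≤ W2sq (law μ.1 T) ν - 1 / δ * ‖T - idLp μ‖ ^ 2 := by
  have : Nonempty (P2 d) := ⟨μ⟩
  obtain ⟨μ', hμ'⟩ := exists_lt_of_lt_ciSup
    (show supConv ν δ μ - ε / 2 < ⨆ μ' : P2 d, (W2sq μ' ν - 1 / δ * W2sq μ' μ) from
      sub_lt_self _ (half_pos hε))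
  obtain ⟨γ, hγ, hlt⟩ := exists_coupling_lt μ' μ (ε := δ * (ε / 2)) (by positivity)
  obtain ⟨T, V, hV, hc, hT⟩ := exists_barycenter (swap_mem_couplings hγ)
  rw [transportCost_swap] at hc
  refine ⟨T, ?_⟩
  have h3 := mul_le_mul_of_nonneg_left hlt.le (by positivity : 0 ≤ 1 / δ)
  have h4 : 1 / δ * (W2sq μ' μ + δ * (ε / 2)) = 1 / δ * W2sq μ' μ + ε / 2 := by field_simp
  have h5 : V ≤ 1 / δ * V := le_mul_of_one_le_left hV (by rw [le_div_iff₀ h0]; linarith)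
  rw [hc, mul_add] at h3
  linarith [hT ν]

/-- Strong concavity of the functional maximised in the sup-convolution. -/
lemma sub_norm_sq_strongConcave (P : Measure Ω) [IsProbabilityMeasure P] (ν : P2 d) (δ : ℝ)
    (x f g : Lp (Euc d) 2 P) {t : ℝ} (h0 : 0 ≤ t) (h1 : t ≤ 1) :
    (1 - t) * (W2sq (law P f) ν - 1 / δ * ‖f - x‖ ^ 2)
      + t * (W2sq (law P g) ν - 1 / δ * ‖g - x‖ ^ 2) + (1 / δ - 1) * (t * (1 - t)) * ‖f - g‖ ^ 2
      ≤ W2sq (law P ((1 - t) • f + t • g)) ν - 1 / δ * ‖(1 - t) • f + t • g - x‖ ^ 2 := by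
  rw [norm_convexComb_sub_sq]
  linarith [W2sq_law_semiconcave P f g ν h0 h1]

/-- The supremum is attained at the image of `μ` under a square-integrable map. -/
lemma exists_map_eq_supConv (ν μ : P2 d) {δ : ℝ} (h0 : 0 < δ) (h1 : δ < 1) :
    ∃ T : Lp (Euc d) 2 μ.1,
      W2sq (law μ.1 T) ν - 1 / δ * ‖T - idLp μ‖ ^ 2 = supConv ν δ μ := by
  set s := supConv ν δ μ with hs
  let J : Lp (Euc d) 2 μ.1 → ℝ := fun T => W2sq (law μ.1 T) ν - 1 / δ * ‖T - idLp μ‖ ^ 2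
  have hJ : ∀ T, J T ≤ s := fun T => by
    have := sub_norm_sq_le_supConv μ.1 ν h0 h1 (idLp μ) T
    rwa [law_idLp] at this
  have hc : 0 < 1 / δ - 1 := by rw [sub_pos, lt_div_iff₀ h0]; linarith
  -- Strong concavity at the midpoint forces maximising sequences to be Cauchy.
  have hmid : ∀ f g, J f + J g + (1 / δ - 1) / 2 * ‖f - g‖ ^ 2 ≤ 2 * s := fun f g => by
    have := sub_norm_sq_strongConcave μ.1 ν δ (idLp μ) f g (t := 1 / 2) (by norm_num) (by norm_num)
    have h2 := hJ ((1 - 1 / 2 : ℝ) • f + (1 / 2 : ℝ) • g)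
    simp only [J] at h2 ⊢
    linarith
  have hex : ∀ n : ℕ, ∃ T, s - 1 / ((n : ℝ) + 1) ≤ J T := fun n =>
    exists_map_near_supConv ν μ h0 h1 Nat.one_div_pos_of_nat
  choose T hT using hex
  have hcauchy : CauchySeq T := by
    rw [Metric.cauchySeq_iff']
    intro ε hε
    obtain ⟨N, hN⟩ := exists_nat_one_div_lt (show 0 < (1 / δ - 1) / 4 * ε ^ 2 by positivity)
    refine ⟨N, fun n hn => ?_⟩
    have hnN : 1 / ((n : ℝ) + 1) ≤ 1 / ((N : ℝ) + 1) := Nat.one_div_le_one_div hn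
    have h3 := hmid (T n) (T N)
    have h4 : (1 / δ - 1) / 2 * ‖T n - T N‖ ^ 2 < (1 / δ - 1) / 2 * ε ^ 2 := by
      linarith [hT n, hT N]
    have h5 := lt_of_mul_lt_mul_left h4 (by positivity)
    rw [dist_eq_norm]
    exact lt_of_pow_lt_pow_left₀ 2 hε.le h5
  obtain ⟨S, hS⟩ := cauchySeq_tendsto_of_complete hcauchy
  refine ⟨S, le_antisymm (hJ S) ?_⟩
  have hn1 : Tendsto (fun n => ‖T n - idLp μ‖ ^ 2) atTop (𝓝 (‖S - idLp μ‖ ^ 2)) :=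
    ((hS.sub_const _).norm).pow 2
  have hn2 : Tendsto (fun n => ‖T n - S‖ ^ 2) atTop (𝓝 0) := by
    simpa using ((hS.sub_const S).norm).pow 2
  -- Only upper semicontinuity of `J` is needed at the limit: `n → ∞` for fixed `θ`, then `θ → 0`.
  have hθ : ∀ θ : ℝ, 0 < θ → s ≤ (1 + θ) * W2sq (law μ.1 S) ν - 1 / δ * ‖S - idLp μ‖ ^ 2 := by
    intro θ hθ
    have hl : Tendsto (fun n : ℕ => s - 1 / ((n : ℝ) + 1)) atTop (𝓝 (s - 0)) :=
      tendsto_const_nhds.sub tendsto_one_div_add_atTop_nhds_zero_nat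
    have hr := ((hn2.const_mul (1 + 1 / θ)).const_add ((1 + θ) * W2sq (law μ.1 S) ν)).sub
      (hn1.const_mul (1 / δ))
    have := le_of_tendsto_of_tendsto' hl hr fun n => by
      have h6 := W2sq_law_le_add μ.1 S (T n) ν hθ
      have h7 := hT n
      simp only [J] at h7
      linarith
    simpa using this
  have hlim : Tendsto (fun θ : ℝ => (1 + θ) * W2sq (law μ.1 S) ν - 1 / δ * ‖S - idLp μ‖ ^ 2)
      (𝓝[>] 0) (𝓝 ((1 + 0) * W2sq (law μ.1 S) ν - 1 / δ * ‖S - idLp μ‖ ^ 2)) := by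
    apply Tendsto.mono_left _ nhdsWithin_le_nhds
    exact Continuous.tendsto (by fun_prop) 0
  have := ge_of_tendsto hlim (by filter_upwards [self_mem_nhdsWithin] with θ h using hθ θ h)
  simpa using this

/-- A map attaining the supremum in the sup-convolution. -/
noncomputable def proxMap (ν μ : P2 d) {δ : ℝ} (h0 : 0 < δ) (h1 : δ < 1) : Lp (Euc d) 2 μ.1 :=
  (exists_map_eq_supConv ν μ h0 h1).choose

lemma proxMap_spec (ν μ : P2 d) {δ : ℝ} (h0 : 0 < δ) (h1 : δ < 1) :
    W2sq (law μ.1 (proxMap ν μ h0 h1)) ν - 1 / δ * ‖proxMap ν μ h0 h1 - idLp μ‖ ^ 2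
      = supConv ν δ μ :=
  (exists_map_eq_supConv ν μ h0 h1).choose_spec

lemma pull_proxMap_spec {P : Measure Ω} [IsProbabilityMeasure P] (ν μ : P2 d) {δ : ℝ}
    (h0 : 0 < δ) (h1 : δ < 1) {X : Ω → Euc d} (hX : MeasurePreserving X P μ.1) :
    W2sq (law P (pull X hX (proxMap ν μ h0 h1))) ν
      - 1 / δ * ‖pull X hX (proxMap ν μ h0 h1) - pull X hX (idLp μ)‖ ^ 2 = supConv ν δ μ := by
  rw [law_pull, ← map_sub, LinearIsometry.norm_map, proxMap_spec]

/-- Quadratic growth around the maximiser, for arbitrary competitors. -/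
lemma sub_norm_sq_add_le_supConv {P : Measure Ω} [IsProbabilityMeasure P] (ν μ : P2 d) {δ : ℝ}
    (h0 : 0 < δ) (h1 : δ < 1) {X : Ω → Euc d} (hX : MeasurePreserving X P μ.1)
    (g : Lp (Euc d) 2 P) :
    W2sq (law P g) ν - 1 / δ * ‖g - pull X hX (idLp μ)‖ ^ 2
      + (1 / δ - 1) * ‖g - pull X hX (proxMap ν μ h0 h1)‖ ^ 2 ≤ supConv ν δ μ := by
  set x := pull X hX (idLp μ) with hx
  set T := pull X hX (proxMap ν μ h0 h1)
  have hT : W2sq (law P T) ν - 1 / δ * ‖T - x‖ ^ 2 = supConv ν δ μ :=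
    pull_proxMap_spec ν μ h0 h1 hX
  -- Strong concavity on the segment from `T` to `g`, with the value at `(1 - t) • T + t • g`
  -- bounded by the supremum, is divided by `t` before `t → 0`.
  have hlim : Tendsto (fun t : ℝ => W2sq (law P g) ν - 1 / δ * ‖g - x‖ ^ 2
      + (1 / δ - 1) * (1 - t) * ‖g - T‖ ^ 2) (𝓝[>] 0)
      (𝓝 (W2sq (law P g) ν - 1 / δ * ‖g - x‖ ^ 2 + (1 / δ - 1) * (1 - 0) * ‖g - T‖ ^ 2)) := by
    apply Tendsto.mono_left _ nhdsWithin_le_nhds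
    exact Continuous.tendsto (by fun_prop) 0
  have := le_of_tendsto hlim (b := supConv ν δ μ) (by
    filter_upwards [Ioo_mem_nhdsGT one_pos] with t ht
    have h2 := sub_norm_sq_strongConcave P ν δ x T g ht.1.le ht.2.le
    have h3 := sub_norm_sq_le_supConv P ν h0 h1 x ((1 - t) • T + t • g)
    rw [hx, law_pull_idLp, ← hx] at h3
    rw [hT, norm_sub_rev T g] at h2
    refine le_of_mul_le_mul_left ?_ ht.1
    linarith)
  simpa using this

end SupConv
-- Differentials of the sup-convolution and supergradients
section Differential

variable {d : ℕ} {Ω : Type*} [MeasurableSpace Ω]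

lemma coeFn_pull_toLp {P : Measure Ω} {μ : P2 d} {X : Ω → Euc d}
    (hX : MeasurePreserving X P μ.1) {φ : Euc d → Euc d} (hφ : MemLp φ 2 μ.1) :
    pull X hX (hφ.toLp φ) =ᵐ[P] fun ω => φ (X ω) :=
  (coeFn_pull hX _).trans (hX.quasiMeasurePreserving.ae_eq_comp hφ.coeFn_toLp)

lemma sqrt_transportCost {μ μ' : P2 d} {γ : Measure (Euc d × Euc d)} (hγ : γ ∈ couplings μ μ') :
    Real.sqrt (transportCost γ) = ‖pull Prod.snd (measurePreserving_snd hγ) (idLp μ')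
      - pull Prod.fst (measurePreserving_fst hγ) (idLp μ)‖ := by
  rw [transportCost_eq_norm_sq hγ, Real.sqrt_sq (norm_nonneg _), norm_sub_rev]

lemma integral_inner_eq {P : Measure Ω} {f g h : Lp (Euc d) 2 P} {u v w : Ω → Euc d}
    (hf : f =ᵐ[P] u) (hg : g =ᵐ[P] v) (hh : h =ᵐ[P] w) :
    inner ℝ f (g - h) = ∫ ω, inner ℝ (u ω) (v ω - w ω) ∂P := by
  rw [MeasureTheory.L2.inner_def]
  apply integral_congr_ae
  filter_upwards [Lp.coeFn_sub g h, hf, hg, hh] with ω h1 h2 h3 h4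
  rw [h1, Pi.sub_apply, h2, h3, h4]

/-- Differentiability in terms of random vectors. -/
lemma HasWDifferentialAt.lift {F : P2 d → ℝ} {μ : P2 d} {φ : Euc d → Euc d}
    (h : HasWDifferentialAt F μ φ) {ε : ℝ} (hε : 0 < ε) :
    ∃ η : ℝ, 0 < η ∧ ∀ (P : Measure Ω) [IsProbabilityMeasure P] (X : Ω → Euc d)
      (hX : MeasurePreserving X P μ.1) (g : Lp (Euc d) 2 P),
      ‖g - pull X hX (idLp μ)‖ ≤ η →
      |F (law P g) - F μ - inner ℝ (pull X hX (h.1.toLp φ)) (g - pull X hX (idLp μ))|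
        ≤ ε * ‖g - pull X hX (idLp μ)‖ := by
  obtain ⟨η, hη, H⟩ := h.2 ε hε
  refine ⟨η, hη, fun P _ X hX g hg => ?_⟩
  have hm := hX.measurable.prodMk (measurable_coeFn_lp g)
  have hc := map_prodMk_mem_couplings hX (measurePreserving_law P g)
  have h1 : Real.sqrt (transportCost (P.map fun ω => (X ω, g ω)))
      = ‖g - pull X hX (idLp μ)‖ := by
    rw [transportCost_map hX.measurable (measurable_coeFn_lp g),
      ← norm_sub_sq_eq_integral (coeFn_pull_idLp hX) (ae_eq_refl g), Real.sqrt_sq (norm_nonneg _),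
      norm_sub_rev]
  have h2 : ∫ p, inner ℝ (φ p.1) (p.2 - p.1) ∂(P.map fun ω => (X ω, g ω))
      = inner ℝ (pull X hX (h.1.toLp φ)) (g - pull X hX (idLp μ)) := by
    have hφ : AEStronglyMeasurable (fun p : Euc d × Euc d => φ p.1)
        (P.map fun ω => (X ω, g ω)) :=
      h.1.1.comp_measurePreserving (measurePreserving_fst hc)
    rw [integral_map hm.aemeasurable (hφ.inner (by fun_prop)),
      integral_inner_eq (coeFn_pull_toLp hX h.1) (ae_eq_refl g) (coeFn_pull_idLp hX)]
  have := H (law P g) _ hc (by rwa [h1])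
  rwa [h1, h2] at this

/-- A first-order expansion with quadratic remainder gives differentiability. -/
lemma hasWDifferentialAt_of_quadratic {F : P2 d → ℝ} {μ : P2 d} (ψ : Lp (Euc d) 2 μ.1) {C : ℝ}
    (hC : 0 < C)
    (H : ∀ (μ' : P2 d) (γ : Measure (Euc d × Euc d)) (hγ : γ ∈ couplings μ μ'),
      |F μ' - F μ - inner ℝ (pull Prod.fst (measurePreserving_fst hγ) ψ)
        (pull Prod.snd (measurePreserving_snd hγ) (idLp μ')
          - pull Prod.fst (measurePreserving_fst hγ) (idLp μ))|
      ≤ C * ‖pull Prod.snd (measurePreserving_snd hγ) (idLp μ')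
          - pull Prod.fst (measurePreserving_fst hγ) (idLp μ)‖ ^ 2) :
    HasWDifferentialAt F μ ψ := by
  refine ⟨Lp.memLp ψ, fun ε hε => ⟨ε / C, by positivity, fun μ' γ hγ hle => ?_⟩⟩
  have := H μ' γ hγ
  rw [integral_inner_eq (coeFn_pull (measurePreserving_fst hγ) ψ) (coeFn_pull_idLp _)
    (coeFn_pull_idLp _), ← sqrt_transportCost hγ] at this
  refine this.trans ?_
  rw [le_div_iff₀ hC] at hle
  nlinarith [Real.sqrt_nonneg (transportCost γ)]

/-- The differential is unique as an element of `L²(μ)`. -/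
lemma HasWDifferentialAt.unique {F : P2 d → ℝ} {μ : P2 d} {φ ψ : Euc d → Euc d}
    (hφ : HasWDifferentialAt F μ φ) (hψ : HasWDifferentialAt F μ ψ) :
    hφ.1.toLp φ = hψ.1.toLp ψ := by
  by_contra hne
  set w := hφ.1.toLp φ - hψ.1.toLp ψ with hw
  have hw0 : 0 < ‖w‖ := norm_pos_iff.2 (sub_ne_zero.2 hne)
  obtain ⟨η₁, hη₁, H₁⟩ := hφ.lift (Ω := Euc d) (ε := ‖w‖ / 4) (by positivity)
  obtain ⟨η₂, hη₂, H₂⟩ := hψ.lift (Ω := Euc d) (ε := ‖w‖ / 4) (by positivity)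
  have hid := MeasurePreserving.id μ.1
  -- Displacing the identity by `c • w` stays within both radii. The two expansions differ by `c *
  -- ‖w‖ ^ 2`, while the errors total at most half of that.
  set c := min η₁ η₂ / ‖w‖ with hcdef
  have hc : 0 < c := by positivity
  have hn : ‖pull id hid (c • w)‖ = c * ‖w‖ := by
    rw [LinearIsometry.norm_map, norm_smul, Real.norm_of_nonneg hc.le]
  have hcw : c * ‖w‖ = min η₁ η₂ := div_mul_cancel₀ _ hw0.ne'
  have h1 := H₁ μ.1 id hid (pull id hid (idLp μ) + pull id hid (c • w))
    (by rw [add_sub_cancel_left, hn, hcw]; exact min_le_left _ _)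
  have h2 := H₂ μ.1 id hid (pull id hid (idLp μ) + pull id hid (c • w))
    (by rw [add_sub_cancel_left, hn, hcw]; exact min_le_right _ _)
  rw [add_sub_cancel_left, hn, LinearIsometry.inner_map_map, real_inner_smul_right] at h1 h2
  have h3 : inner ℝ (hφ.1.toLp φ) w - inner ℝ (hψ.1.toLp ψ) w = ‖w‖ ^ 2 := by
    rw [← inner_sub_left, ← hw, real_inner_self_eq_norm_sq]
  have h4 : c * inner ℝ (hφ.1.toLp φ) w - c * inner ℝ (hψ.1.toLp ψ) w = c * ‖w‖ ^ 2 := by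
    rw [← mul_sub, h3]
  have h5 : 0 < c * ‖w‖ ^ 2 := by positivity
  rw [abs_le] at h1 h2
  linarith [h1.1, h2.2]

/-- The differential of the sup-convolution. -/
noncomputable def supConvDifferential (ν μ : P2 d) {δ : ℝ} (h0 : 0 < δ) (h1 : δ < 1) :
    Lp (Euc d) 2 μ.1 :=
  (2 * (1 / δ)) • (proxMap ν μ h0 h1 - idLp μ)

/-- An envelope argument. The maximiser for `μ`, tested at `μ'`, gives the lower bound. The one for
`μ'`, tested at `μ`, gives the upper bound up to the cross term `2k⟨t' - t, y - x⟩`, which the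
growth term `(k - 1)‖t' - t‖²` absorbs at the price of `k²/(k - 1)‖y - x‖²`. -/
lemma hasWDifferentialAt_supConv (ν μ : P2 d) {δ : ℝ} (h0 : 0 < δ) (h1 : δ < 1) :
    HasWDifferentialAt (supConv ν δ) μ (supConvDifferential ν μ h0 h1) := by
  have hk : 0 < 1 / δ - 1 := by rw [sub_pos, lt_div_iff₀ h0]; linarith
  refine hasWDifferentialAt_of_quadratic _ (C := 1 / δ + (1 / δ) ^ 2 / (1 / δ - 1))
    (by positivity) fun μ' γ hγ => ?_
  have := hγ.1
  set k := 1 / δ with hkdef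
  set hX := measurePreserving_fst hγ
  set hY := measurePreserving_snd hγ
  rw [supConvDifferential, map_smul, map_sub, real_inner_smul_left]
  set x := pull Prod.fst hX (idLp μ) with hx
  set y := pull Prod.snd hY (idLp μ') with hy
  set t := pull Prod.fst hX (proxMap ν μ h0 h1)
  set t' := pull Prod.snd hY (proxMap ν μ' h0 h1)
  have e1 : W2sq (law γ t) ν - k * ‖t - x‖ ^ 2 = supConv ν δ μ := pull_proxMap_spec ν μ h0 h1 hX
  have e2 : W2sq (law γ t') ν - k * ‖t' - y‖ ^ 2 = supConv ν δ μ' :=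
    pull_proxMap_spec ν μ' h0 h1 hY
  have i1 : W2sq (law γ t) ν - k * ‖t - y‖ ^ 2 ≤ supConv ν δ μ' := by
    have := sub_norm_sq_le_supConv γ ν h0 h1 y t
    rwa [hy, law_pull_idLp] at this
  have i2 : W2sq (law γ t') ν - k * ‖t' - x‖ ^ 2 + (k - 1) * ‖t' - t‖ ^ 2 ≤ supConv ν δ μ :=
    sub_norm_sq_add_le_supConv ν μ h0 h1 hX t'
  have n1 : ‖t - y‖ ^ 2 = ‖t - x‖ ^ 2 - 2 * inner ℝ (t - x) (y - x) + ‖y - x‖ ^ 2 := by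
    rw [← norm_sub_sq_real]; congr 2; abel
  have n2 : ‖t' - y‖ ^ 2 = ‖t' - x‖ ^ 2 - 2 * inner ℝ (t' - x) (y - x) + ‖y - x‖ ^ 2 := by
    rw [← norm_sub_sq_real]; congr 2; abel
  have n3 : inner ℝ (t' - x) (y - x) = inner ℝ (t' - t) (y - x) + inner ℝ (t - x) (y - x) := by
    rw [← inner_add_left]; congr 1; abel
  have n4 := real_inner_le_norm (t' - t) (y - x)
  have n5 : 2 * k * (‖t' - t‖ * ‖y - x‖)
      ≤ (k - 1) * ‖t' - t‖ ^ 2 + k ^ 2 / (k - 1) * ‖y - x‖ ^ 2 := by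
    have h3 : 0 ≤ ((k - 1) * ‖t' - t‖ - k * ‖y - x‖) ^ 2 / (k - 1) := by positivity
    have h4 : ((k - 1) * ‖t' - t‖ - k * ‖y - x‖) ^ 2 / (k - 1) = (k - 1) * ‖t' - t‖ ^ 2
        - 2 * k * (‖t' - t‖ * ‖y - x‖) + k ^ 2 / (k - 1) * ‖y - x‖ ^ 2 := by
      field_simp
      ring
    linarith
  have hk0 : 0 < k := by positivity
  have n6 := mul_le_mul_of_nonneg_left n4 (by positivity : 0 ≤ 2 * k)
  have n7 : 0 ≤ k ^ 2 / (k - 1) * ‖y - x‖ ^ 2 := by positivity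
  have n8 : 0 ≤ k * ‖y - x‖ ^ 2 := by positivity
  rw [abs_le]
  constructor
  · rw [n1] at i1
    linarith
  · rw [n2, n3] at e2
    linarith

/-- The displacement towards the maximiser in the sup-convolution is small for small `δ`. -/
lemma norm_proxMap_sub_sq_le {P : Measure Ω} [IsProbabilityMeasure P] (ν μ : P2 d) {δ : ℝ}
    (h0 : 0 < δ) (h1 : δ < 1) (h2 : δ < 1 / 2) {X : Ω → Euc d} (hX : MeasurePreserving X P μ.1)
    (f : Lp (Euc d) 2 P) :
    ‖pull X hX (proxMap ν μ h0 h1) - pull X hX (idLp μ)‖ ^ 2 ≤ δ / (1 - 2 * δ)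
      * (2 * W2sq (law P f) ν + 2 * ‖pull X hX (idLp μ) - f‖ ^ 2) := by
  set x := pull X hX (idLp μ) with hx
  set t := pull X hX (proxMap ν μ h0 h1)
  have e : W2sq (law P t) ν - 1 / δ * ‖t - x‖ ^ 2 = supConv ν δ μ := pull_proxMap_spec ν μ h0 h1 hX
  have i1 := sub_norm_sq_le_supConv P ν h0 h1 x x
  have i2 := W2sq_law_le_add P x t ν one_pos
  have i3 := W2sq_law_le_add P f x ν one_pos
  have e2 : law P x = μ := law_pull_idLp hX
  rw [e2] at i1
  simp only [sub_self, norm_zero] at i1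
  have h3 : 0 < 1 - 2 * δ := by linarith
  -- Staying at `x` is a competitor, so the penalty is at most the gain `U t - U x`. Moving `2 * ‖t
  -- - x‖ ^ 2` to the left leaves the factor `1/δ - 2`, whence `δ < 1/2`.
  have i4 : 1 / δ * ‖t - x‖ ^ 2 ≤ W2sq (law P x) ν + 2 * ‖t - x‖ ^ 2 := by
    rw [e2] at i2 ⊢
    linarith
  rw [div_mul_eq_mul_div, le_div_iff₀ h3]
  have i5 := mul_le_mul_of_nonneg_left i4 h0.le
  rw [← mul_assoc, mul_one_div_cancel h0.ne'] at i5
  have i6 := mul_le_mul_of_nonneg_left i3 h0.le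
  linarith

/-- The rescaled displacement is a supergradient, up to a quadratic error, at the maximiser. -/
lemma W2sq_law_le_supergradient {P : Measure Ω} [IsProbabilityMeasure P] (ν μ : P2 d) {δ : ℝ}
    (h0 : 0 < δ) (h1 : δ < 1) {X : Ω → Euc d} (hX : MeasurePreserving X P μ.1)
    (g : Lp (Euc d) 2 P) :
    W2sq (law P g) ν ≤ W2sq (law P (pull X hX (proxMap ν μ h0 h1))) ν
      + inner ℝ (pull X hX (supConvDifferential ν μ h0 h1))
        (g - pull X hX (proxMap ν μ h0 h1)) + ‖g - pull X hX (proxMap ν μ h0 h1)‖ ^ 2 := by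
  have i := sub_norm_sq_add_le_supConv ν μ h0 h1 hX g
  rw [← pull_proxMap_spec ν μ h0 h1 hX] at i
  rw [supConvDifferential, map_smul, map_sub, real_inner_smul_left]
  -- Expanding `‖g - x‖ ^ 2` about `t` yields `1/δ` times `‖g - t‖ ^ 2`; the growth term removes
  -- `1/δ - 1` of it, leaving coefficient `1` for every `δ`.
  set x := pull X hX (idLp μ)
  set t := pull X hX (proxMap ν μ h0 h1)
  have n : ‖g - x‖ ^ 2 = ‖t - x‖ ^ 2 + 2 * inner ℝ (t - x) (g - t) + ‖g - t‖ ^ 2 := by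
    rw [← norm_add_sq_real]; congr 2; abel
  rw [n] at i
  linarith

/-- Supergradients at a point near a point of differentiability are close to the gradient. -/
lemma norm_sub_le_of_supergradient {H : Type*} [NormedAddCommGroup H] [InnerProductSpace ℝ H]
    {F : H → ℝ} {x y φ p : H} {ε r : ℝ} (hr : 0 < r) (hε : 0 < ε)
    (hd : ∀ g, ‖g - x‖ ≤ r → |F g - F x - inner ℝ φ (g - x)| ≤ ε * ‖g - x‖)
    (hp : ∀ g, F g ≤ F y + inner ℝ p (g - y) + ‖g - y‖ ^ 2) (hy : ‖y - x‖ ≤ r / 2) :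
    ‖φ - p‖ ≤ 3 * ε + 5 * r := by
  rcases eq_or_ne (φ - p) 0 with h0 | h0
  · rw [h0, norm_zero]; positivity
  have hD : 0 < ‖φ - p‖ := norm_pos_iff.2 h0
  -- `F (x + h)` is bounded below by differentiability at `x` and above by the supergradient at `y`.
  -- Since `‖y - x‖ ≤ r / 2`, the term `⟨φ - p, y - x⟩` consumes at most half of `⟨φ - p, h⟩ = r *
  -- ‖φ - p‖`.
  set h := (r / ‖φ - p‖) • (φ - p) with hh
  have hn : ‖h‖ = r := by
    rw [hh, norm_smul, Real.norm_of_nonneg (by positivity), div_mul_cancel₀ _ hD.ne']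
  have hin : inner ℝ (φ - p) h = r * ‖φ - p‖ := by
    rw [hh, real_inner_smul_right, real_inner_self_eq_norm_sq]
    field_simp
  have h1 := hd (x + h) (by rw [add_sub_cancel_left, hn])
  have h2 := hd y (by linarith)
  rw [add_sub_cancel_left, hn] at h1
  have h3 := hp (x + h)
  have h4 : inner ℝ p (x + h - y) = inner ℝ p h - inner ℝ p (y - x) := by
    rw [← inner_sub_right]; congr 1; abel
  have h5 : ‖x + h - y‖ ≤ r + r / 2 := by
    rw [show x + h - y = h - (y - x) by abel]
    exact (norm_sub_le _ _).trans (by rw [hn]; linarith)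
  have h6 : ‖x + h - y‖ ^ 2 ≤ (r + r / 2) ^ 2 := by gcongr
  have h7 : inner ℝ (φ - p) (y - x) ≤ ‖φ - p‖ * (r / 2) :=
    (real_inner_le_norm _ _).trans (by gcongr)
  rw [inner_sub_left] at hin h7
  have h8 : ε * ‖y - x‖ ≤ ε * (r / 2) := by gcongr
  rw [abs_le] at h1 h2
  have h9 : r * ‖φ - p‖ ≤ r * (3 * ε + 5 * r) := by nlinarith [h1.1, h2.2]
  exact le_of_mul_le_mul_left h9 hr

end Differential

/-! ### Convergence of the differentials -/

theorem mainTheorem4 {d : ℕ} (ν μ : P2 d)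
    (φ : EuclideanSpace ℝ (Fin d) → EuclideanSpace ℝ (Fin d))
    (hφ : HasWDifferentialAt (fun m => W2sq m ν) μ φ)
    (δ : ℕ → ℝ) (hδpos : ∀ n, 0 < δ n) (hδ : Tendsto δ atTop (𝓝 0))
    (μs : ℕ → P2 d) (hμs : Tendsto (fun n => W2 (μs n) μ) atTop (𝓝 0))
    (γ : ℕ → Measure (EuclideanSpace ℝ (Fin d) × EuclideanSpace ℝ (Fin d)))
    (hγ : ∀ n, γ n ∈ couplings μ (μs n))
    (hcost : Tendsto (fun n => transportCost (γ n)) atTop (𝓝 0)) :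
    (∀ n, δ n < 1 → ∃ ψ, HasWDifferentialAt (supConv ν (δ n)) (μs n) ψ) ∧
    ∀ ψ : ℕ → EuclideanSpace ℝ (Fin d) → EuclideanSpace ℝ (Fin d),
      (∀ n, δ n < 1 → HasWDifferentialAt (supConv ν (δ n)) (μs n) (ψ n)) →
      Tendsto (fun n => ∫ p, ‖ψ n p.2 - φ p.1‖ ^ 2 ∂(γ n)) atTop (𝓝 0) := by
  refine ⟨fun n hn => ⟨_, hasWDifferentialAt_supConv ν (μs n) (hδpos n) hn⟩, fun ψ hψ => ?_⟩
  rw [Metric.tendsto_atTop']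
  intro e he
  -- The `8` comes from `3 * ε + 5 * r` with `r ≤ ε`.
  obtain ⟨ε, hε, hεe⟩ : ∃ ε > 0, (8 * ε) ^ 2 < e :=
    ⟨Real.sqrt e / 16, by positivity, by
      rw [show 8 * (Real.sqrt e / 16) = Real.sqrt e / 2 by ring, div_pow, Real.sq_sqrt he.le]
      linarith⟩
  -- The radius `η` serves all the measures `γ n` at once, by uniformity over couplings.
  obtain ⟨η, hη, H⟩ := hφ.lift (Ω := Euc d × Euc d) hε
  set r := min ε η with hrdef
  have hr : 0 < r := lt_min hε hη
  -- This sequence will dominate `‖t - x‖ ^ 2`: twice the squared displacement to the maximiser plus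
  -- twice the cost of `γ n`.
  have hbound : Tendsto (fun n => 2 * (δ n / (1 - 2 * δ n)
      * (2 * W2sq μ ν + 2 * transportCost (γ n))) + 2 * transportCost (γ n)) atTop (𝓝 0) := by
    have h1 : Tendsto (fun n => δ n / (1 - 2 * δ n)) atTop (𝓝 (0 / (1 - 2 * 0))) :=
      hδ.div ((hδ.const_mul 2).const_sub 1) (by norm_num)
    have h2 := ((h1.mul ((hcost.const_mul 2).const_add (2 * W2sq μ ν))).const_mul 2).add
      (hcost.const_mul 2)
    simpa using h2
  obtain ⟨N, hN⟩ := eventually_atTop.1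
    ((hδ.eventually_lt_const (show (0 : ℝ) < 1 / 2 by norm_num)).and (hbound.eventually_lt_const (show 0 < (r / 2) ^ 2 by positivity)))
  refine ⟨N, fun n hnN => ?_⟩
  obtain ⟨hδ2, hsmall⟩ := hN n hnN.le
  have hδ1 : δ n < 1 := by linarith
  have := (hγ n).1
  set hX := measurePreserving_fst (hγ n)
  set hY := measurePreserving_snd (hγ n)
  have hψn := hψ n hδ1
  have hD := hasWDifferentialAt_supConv ν (μs n) (hδpos n) hδ1
  have heq : hψn.1.toLp (ψ n) = supConvDifferential ν (μs n) (hδpos n) hδ1 := by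
    rw [hψn.unique hD, Lp.toLp_coeFn]
  have hint : ∫ p, ‖ψ n p.2 - φ p.1‖ ^ 2 ∂(γ n) = ‖pull Prod.fst hX (hφ.1.toLp φ)
      - pull Prod.snd hY (supConvDifferential ν (μs n) (hδpos n) hδ1)‖ ^ 2 := by
    rw [norm_sub_rev, ← heq,
      norm_sub_sq_eq_integral (coeFn_pull_toLp hY hψn.1) (coeFn_pull_toLp hX hφ.1)]
  set x := pull Prod.fst hX (idLp μ) with hx
  have hlaw : law (γ n) x = μ := law_pull_idLp hX
  set t := pull Prod.snd hY (proxMap ν (μs n) (hδpos n) hδ1) with ht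
  have hclose : ‖t - x‖ ≤ r / 2 := by
    have h1 := norm_proxMap_sub_sq_le ν (μs n) (hδpos n) hδ1 hδ2 hY x
    have hc : transportCost (γ n) = ‖pull Prod.snd hY (idLp (μs n)) - x‖ ^ 2 := by
      rw [transportCost_eq_norm_sq (hγ n), norm_sub_rev]
    rw [hlaw, ← hc, ← ht] at h1
    have h2 := norm_add_sq_le (t - pull Prod.snd hY (idLp (μs n)))
      (pull Prod.snd hY (idLp (μs n)) - x) one_pos
    rw [sub_add_sub_cancel, ← hc] at h2
    refine (lt_of_pow_lt_pow_left₀ 2 (by positivity) ?_).le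
    linarith
  have hle := norm_sub_le_of_supergradient (F := fun g => W2sq (law (γ n) g) ν) hr hε
    (fun g hg => by
      have := H (γ n) Prod.fst hX g (hg.trans (min_le_right _ _))
      rw [hlaw]
      exact this)
    (W2sq_law_le_supergradient ν (μs n) (hδpos n) hδ1 hY) hclose
  have hle2 : ‖pull Prod.fst hX (hφ.1.toLp φ)
      - pull Prod.snd hY (supConvDifferential ν (μs n) (hδpos n) hδ1)‖ ^ 2 ≤ (8 * ε) ^ 2 := by
    have : r ≤ ε := min_le_left _ _
    gcongr
    linarith
  rw [hint, Real.dist_eq, sub_zero, abs_of_nonneg (by positivity)]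
  linarith
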